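/- Let $L$ be a frame, and let $\mathsf{S}(L)$ be the coframe of its sublocales (subsets $S\subseteq L$ closed under arbitrary meets and such that $a\to s\in S$ for all $a\in L$, $s\in S$), ordered by inclusion. For $x\in L$ let $\mathfrak{o}(x)=\{b\in L\mid x\to b=b\}$ be the open sublocale of $x$, and for $S\in\mathsf{S}(L)$ let $\mathit{fit}(S)=\bigcap\{\mathfrak{o}(x)\mid x\in L,\ S\subseteq\mathfrak{o}(x)\}$; for $\mathcal{D}\subseteq\mathsf{S}(L)$ write $\mathit{fit}[\mathcal{D}]=\{\mathit{fit}(D)\mid D\in\mathcal{D}\}$. Let $\mathsf{S}_b(L)$ be the collection of all joins in $\mathsf{S}(L)$ of complemented sublocales. A meet $\bigwedge_i x_i$ in a frame is exact if $(\bigwedge_i x_i)\vee y=\bigwedge_i(x_i\vee y)$ for all $y$; a frame homomorphism $f$ is exact if, whenever $\bigwedge_i x_i$ is an exact meet, $\bigwedge_i f(x_i)$ is exact and equals $f(\bigwedge_i x_i)$. Let $\mathsf{S}_{\mathcal{E}}(L)$ be the collection of exact sublocales, that is, of those $S\in\mathsf{S}(L)$ whose frame surjection $L\to S$, $a\mapsto\bigwedge\{s\in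 S\mid a\le s\}$, is exact. A subcolocale of a coframe $C$ is a subset $D\subseteq C$ closed under arbitrary joins and such that $d\setminus c=\bigwedge\{z\in C\mid d\le c\vee z\}\in D$ for all $d\in D$, $c\in C$; it is codense if $1\in D$. A codense subcolocale $\mathcal{D}\subseteq\mathsf{S}(L)$ is essential if it is the smallest subcolocale of $\mathsf{S}(L)$ containing all the meets, computed in $\mathcal{D}$, of families of open sublocales, i.e. all the sublocales $\bigvee\{D\in\mathcal{D}\mid D\subseteq\bigcap_i\mathfrak{o}(x_i)\}$ for families $(x_i)_i$ in $L$. Then: (1) for every frame $L$, $\mathit{fit}[\mathsf{S}_b(L)]=\mathit{fit}[\mathsf{S}_{\mathcal{E}}(L)]$; (2) there is a frame $L$ such that the map $\mathcal{D}\mapsto\mathit{fit}[\mathcal{D}]$ is not injective on the codense subcolocales of $\mathsf{S}(L)$, and such that $\mathsf{S}_{\mathcal{E}}(L)$ is a codense subcolocale of $\mathsf{S}(L)$ which is not essential. -/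

import Mathlib

namespace PointfreeFit

section Sublocales

variable {L : Type*} [Order.Frame L]

/-- The open sublocale `𝔬(a) = {b | a ⇨ b = b}`. -/
def openSublocale (a : L) : Sublocale L where
  carrier := {b | a ⇨ b = b}
  sInf_mem' s hs := by
    refine le_antisymm (le_sInf fun b hb => ?_) le_himp
    have h : a ⇨ b = b := hs hb
    exact (himp_le_himp_left (sInf_le hb)).trans h.le
  himp_mem' c b hb := by
    have h : a ⇨ b = b := hb
    change a ⇨ (c ⇨ b) = c ⇨ b
    rw [himp_left_comm, h]

/-- The fitting of a sublocale: the intersection (the meet in the coframe `Sublocale L`) of all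
open sublocales containing it. -/
def fit (S : Sublocale L) : Sublocale L :=
  sInf {T | ∃ x : L, T = openSublocale x ∧ S ≤ T}

/-- The meet of `A` is exact: it distributes over binary joins. -/
def IsExactMeet (A : Set L) : Prop :=
  ∀ y : L, sInf A ⊔ y = ⨅ x ∈ A, x ⊔ y

/-- A frame homomorphism is exact if it sends exact meets to exact meets and preserves them. -/
def IsExactHom {M : Type*} [Order.Frame M] (f : FrameHom L M) : Prop :=
  ∀ A : Set L, IsExactMeet A → IsExactMeet (f '' A) ∧ sInf (f '' A) = f (sInf A)

/-- A sublocale is exact if the associated frame surjection `L → S` is exact. -/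
def IsExactSublocale (S : Sublocale L) : Prop :=
  IsExactHom S.restrict

variable (L) in
/-- `S_b(L)`: the joins of complemented sublocales. -/
def joinsOfComplemented : Set (Sublocale L) :=
  {S | ∃ C : Set (Sublocale L), (∀ T ∈ C, IsComplemented T) ∧ S = sSup C}

variable (L) in
/-- `S_E(L)`: the exact sublocales. -/
def exactSublocales : Set (Sublocale L) :=
  {S | IsExactSublocale S}

end Sublocales

section Subcolocales

variable {C : Type*} [Order.Coframe C]

/-- A subcolocale of a coframe: a subset closed under all joins and under `d ↦ d \ c` for every
`c` in the coframe, where `\` is the co-Heyting difference. -/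
structure IsSubcolocale (D : Set C) : Prop where
  sSup_mem : ∀ A ⊆ D, sSup A ∈ D
  sdiff_mem : ∀ d ∈ D, ∀ c : C, d \ c ∈ D

/-- A subcolocale is codense if it contains the top element. -/
def IsCodenseSubcolocale (D : Set C) : Prop :=
  IsSubcolocale D ∧ ⊤ ∈ D

/-- The conucleus (interior operator) of a subcolocale. -/
def conucleus (D : Set C) (c : C) : C :=
  sSup {d | d ∈ D ∧ d ≤ c}

/-- The smallest subcolocale containing `X`. -/
def generatedSubcolocale (X : Set C) : Set C :=
  ⋂₀ {D | IsSubcolocale D ∧ X ⊆ D}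

end Subcolocales

section Essential

variable {L : Type*} [Order.Frame L]

/-- The saturated elements of `D ⊆ S(L)`: the meets, computed in `D`, of families of open
sublocales. -/
def saturated (D : Set (Sublocale L)) : Set (Sublocale L) :=
  {S | ∃ A : Set L, S = conucleus D (sInf (openSublocale '' A))}

/-- A codense subcolocale `D ⊆ S(L)` is essential if it is generated by its saturated elements. -/
def IsEssential (D : Set (Sublocale L)) : Prop :=
  D = generatedSubcolocale (saturated D)

end Essential

end PointfreeFit

/-!
The fitting of a sublocale depends only on the set of opens containing it. If `S` is exact, this
set is an exact filter `F`, and the supplement of `⨆ x ∈ F, 𝔠(x)`, which is a join of complemented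
sublocales, lies in exactly the opens of `F`; hence exact sublocales have no fittings beyond those
of joins of complemented sublocales.

The exact sublocales form a codense subcolocale, and the joins of complemented sublocales form the
smallest one. In a frame where every meet is exact the meets of opens computed among the exact
sublocales are open, so they generate at most the joins of complemented sublocales, and any exact
sublocale outside that collection refutes both essentiality and injectivity. For the lower sets of
a dense linear order, the left-closed ones form such a sublocale: the nucleus
`s ↦ {p | Iio p ⊆ s}` preserves all meets, but no nonzero locally closed sublocale avoids every
`Iio p`.
-/

namespace PointfreeFit

section Coframe

variable {C : Type*} [Order.Coframe C]

theorem sdiff_eq_inf_of_isCompl {c d : C} (h : IsCompl c d) (a : C) : a \ c = a ⊓ d :=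
  eq_of_forall_ge_iff fun _ => sdiff_le_iff'.trans h.symm.le_sup_right_iff_inf_left_le

theorem sSup_mem_range_hnot {A : Set C} (hA : A ⊆ Set.range (￢·)) : sSup A ∈ Set.range (￢·) := by
  refine ⟨￢sSup A, hnot_hnot_le.antisymm (sSup_le fun a ha => ?_)⟩
  obtain ⟨b, rfl⟩ := hA ha
  exact (hnot_hnot_hnot b).ge.trans (hnot_anti (hnot_anti (le_sSup ha)))

variable (C) in
theorem isCodenseSubcolocale_range_hnot : IsCodenseSubcolocale (Set.range (￢· : C → C)) where
  left :=
    { sSup_mem := fun _ => sSup_mem_range_hnot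
      sdiff_mem := by
        rintro _ ⟨b, rfl⟩ c
        exact ⟨b ⊔ c, by simp only [← top_sdiff', sdiff_sdiff_left]⟩ }
  right := ⟨⊥, hnot_bot⟩

theorem IsCodenseSubcolocale.range_hnot_subset {D : Set C} (hD : IsCodenseSubcolocale D) :
    Set.range (￢·) ⊆ D := by
  rintro _ ⟨b, rfl⟩
  simpa only [top_sdiff'] using hD.1.sdiff_mem ⊤ hD.2 b

theorem generatedSubcolocale_subset {X D : Set C} (hD : IsSubcolocale D) (hX : X ⊆ D) :
    generatedSubcolocale X ⊆ D :=
  Set.sInter_subset_of_mem ⟨hD, hX⟩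

end Coframe

section Nucleus

variable {L : Type*} [Order.Frame L] {S T : Sublocale L} {x y : L}

theorem isLeast_toNucleus (S : Sublocale L) (x : L) :
    IsLeast {y | y ∈ S ∧ x ≤ y} (S.toNucleus x) :=
  ⟨⟨(S.restrict x).2, Nucleus.le_apply⟩, fun y hy => S.giRestrict.gc.l_le (b := ⟨y, hy.1⟩) hy.2⟩

theorem toNucleus_mem (S : Sublocale L) (x : L) : S.toNucleus x ∈ S :=
  (isLeast_toNucleus S x).1.1

theorem toNucleus_le (hy : y ∈ S) (h : x ≤ y) : S.toNucleus x ≤ y :=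
  (isLeast_toNucleus S x).2 ⟨hy, h⟩

theorem toNucleus_eq_self (hx : x ∈ S) : S.toNucleus x = x :=
  (toNucleus_le hx le_rfl).antisymm Nucleus.le_apply

theorem toNucleus_iSup {ι : Sort*} (S : ι → Sublocale L) (x : L) :
    (⨆ i, S i).toNucleus x = ⨅ i, (S i).toNucleus x := by
  have h : (⨆ i, S i).toNucleus = ⨅ i, (S i).toNucleus :=
    nucleusIsoSublocale.symm.map_iSup S
  rw [h, iInf, Nucleus.sInf_apply, iInf_range]

theorem mem_inf : x ∈ S ⊓ T ↔ x ∈ S ∧ x ∈ T := by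
  let U : Sublocale L :=
    { carrier := S ∩ T
      sInf_mem' := fun _ hs =>
        ⟨Sublocale.sInf_mem fun _ hz => (hs hz).1, Sublocale.sInf_mem fun _ hz => (hs hz).2⟩
      himp_mem' := fun _ _ hb => ⟨Sublocale.himp_mem hb.1, Sublocale.himp_mem hb.2⟩ }
  have hU : U ≤ S ⊓ T := le_inf (fun _ hz => hz.1) (fun _ hz => hz.2)
  exact ⟨fun h => ⟨(inf_le_left : S ⊓ T ≤ S) h, (inf_le_right : S ⊓ T ≤ T) h⟩, @hU x⟩

theorem mem_bot : x ∈ (⊥ : Sublocale L) ↔ x = ⊤ := by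
  let U : Sublocale L :=
    { carrier := {⊤}
      sInf_mem' := fun _ hs => sInf_eq_top.2 hs
      himp_mem' := fun _ _ hb => by rw [Set.mem_singleton_iff.1 hb, himp_top]; rfl }
  exact ⟨fun h => (bot_le : ⊥ ≤ U) h, by rintro rfl; exact Sublocale.top_mem⟩

end Nucleus

section OpenClosed

variable {L : Type*} [Order.Frame L] {S : Sublocale L} {a b x y : L}

/-- The closed sublocale `𝔠(a) = ↑a`, the complement of `𝔬(a)`. -/
def closedSublocale (a : L) : Sublocale L where
  carrier := Set.Ici a
  sInf_mem' _ hs := le_sInf hs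
  himp_mem' _ _ hb := le_trans hb le_himp

theorem mem_closedSublocale : b ∈ closedSublocale a ↔ a ≤ b := Iff.rfl

theorem mem_openSublocale : b ∈ openSublocale a ↔ a ⇨ b = b := Iff.rfl

theorem isCompl_closedSublocale_openSublocale (a : L) :
    IsCompl (closedSublocale a) (openSublocale a) where
  disjoint := disjoint_iff_inf_le.2 fun b hb => by
    obtain ⟨hc, ho⟩ := mem_inf.1 hb
    rw [mem_bot, ← mem_openSublocale.1 ho, himp_eq_top_iff]
    exact hc
  codisjoint := fun S hc ho x _ => by
    have h : x = (a ⊔ x) ⊓ (a ⇨ x) := by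
      rw [inf_sup_right, inf_himp, inf_eq_left.2 le_himp, sup_eq_right.2 inf_le_right]
    rw [h]
    exact Sublocale.inf_mem (hc (mem_closedSublocale.2 le_sup_left))
      (ho (mem_openSublocale.2 himp_idem))

theorem toNucleus_inf_closedSublocale (S : Sublocale L) (a x : L) :
    (S ⊓ closedSublocale a).toNucleus x = S.toNucleus (x ⊔ a) := by
  refine (isLeast_toNucleus _ x).unique ⟨⟨mem_inf.2 ⟨toNucleus_mem _ _, ?_⟩, ?_⟩, ?_⟩
  · exact mem_closedSublocale.2 (le_sup_right.trans Nucleus.le_apply)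
  · exact le_sup_left.trans Nucleus.le_apply
  · rintro z ⟨hz, hxz⟩
    exact toNucleus_le (mem_inf.1 hz).1 (sup_le hxz (mem_inf.1 hz).2)

theorem toNucleus_closedSublocale (a x : L) : (closedSublocale a).toNucleus x = x ⊔ a :=
  (isLeast_toNucleus _ x).unique
    ⟨⟨mem_closedSublocale.2 le_sup_right, le_sup_left⟩, fun _ hz => sup_le hz.2 hz.1⟩

theorem toNucleus_inf_openSublocale (S : Sublocale L) (a x : L) :
    (S ⊓ openSublocale a).toNucleus x = a ⇨ S.toNucleus x := by
  refine (isLeast_toNucleus _ x).unique ⟨⟨mem_inf.2 ⟨?_, ?_⟩, ?_⟩, ?_⟩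
  · exact Sublocale.himp_mem (toNucleus_mem _ _)
  · exact mem_openSublocale.2 himp_idem
  · exact Nucleus.le_apply.trans le_himp
  · rintro z ⟨hz, hxz⟩
    rw [← mem_openSublocale.1 (mem_inf.1 hz).2]
    exact himp_le_himp_left (toNucleus_le (mem_inf.1 hz).1 hxz)

theorem le_closedSublocale_iff : S ≤ closedSublocale y ↔ y ≤ S.toNucleus ⊥ :=
  ⟨fun h => h (toNucleus_mem S ⊥), fun h _ hs => h.trans (toNucleus_le hs bot_le)⟩

theorem le_openSublocale_sup_closedSublocale_iff :
    S ≤ openSublocale x ⊔ closedSublocale y ↔ y ≤ S.toNucleus x := by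
  rw [sup_comm, (isCompl_closedSublocale_openSublocale x).le_sup_right_iff_inf_left_le,
    le_closedSublocale_iff, toNucleus_inf_closedSublocale, bot_sup_eq]

theorem le_openSublocale_iff : S ≤ openSublocale x ↔ S.toNucleus x = ⊤ := by
  have h : closedSublocale (⊤ : L) = ⊥ := eq_bot_iff.2 fun _ hb => mem_bot.2 (top_le_iff.1 hb)
  rw [← top_le_iff, ← le_openSublocale_sup_closedSublocale_iff, h, sup_bot_eq]

theorem openSublocale_mono : Monotone (openSublocale : L → Sublocale L) := fun _ _ h =>
  le_openSublocale_iff.2 <| top_le_iff.1 <|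
    (le_openSublocale_iff.1 le_rfl).ge.trans (Nucleus.monotone h)

theorem closedSublocale_inf_openSublocale_eq_bot (h : b ≤ a) :
    closedSublocale a ⊓ openSublocale b = ⊥ :=
  ((isCompl_closedSublocale_openSublocale b).disjoint.mono_left fun _ hz => h.trans hz).eq_bot

theorem eq_iInf_openSublocale_sup_closedSublocale (T : Sublocale L) :
    T = ⨅ x, openSublocale x ⊔ closedSublocale (T.toNucleus x) := by
  refine le_antisymm (le_iInf fun x => le_openSublocale_sup_closedSublocale_iff.2 le_rfl) ?_
  rw [← Sublocale.toNucleus_le_toNucleus]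
  exact fun x => le_openSublocale_sup_closedSublocale_iff.1 (iInf_le _ x)

theorem sdiff_eq_iSup_inf_closedSublocale_inf_openSublocale (S T : Sublocale L) :
    S \ T = ⨆ x, S ⊓ (closedSublocale x ⊓ openSublocale (T.toNucleus x)) := by
  conv_lhs => rw [eq_iInf_openSublocale_sup_closedSublocale T, sdiff_iInf_eq]
  exact iSup_congr fun x => sdiff_eq_inf_of_isCompl
    ((isCompl_closedSublocale_openSublocale x).symm.sup_inf
      (isCompl_closedSublocale_openSublocale _)) S

theorem hnot_eq_iSup_closedSublocale_inf_openSublocale (T : Sublocale L) :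
    ￢T = ⨆ x, closedSublocale x ⊓ openSublocale (T.toNucleus x) := by
  simp only [← top_sdiff', sdiff_eq_iSup_inf_closedSublocale_inf_openSublocale, top_inf_eq]

theorem isComplemented_openSublocale (a : L) : IsComplemented (openSublocale a) :=
  ⟨_, (isCompl_closedSublocale_openSublocale a).symm⟩

theorem isComplemented_closedSublocale (a : L) : IsComplemented (closedSublocale a) :=
  ⟨_, isCompl_closedSublocale_openSublocale a⟩

variable (L) in
theorem joinsOfComplemented_eq_range_hnot : joinsOfComplemented L = Set.range (￢·) := by
  refine Set.Subset.antisymm ?_ ?_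
  · rintro _ ⟨C, hC, rfl⟩
    refine sSup_mem_range_hnot fun T hT => ?_
    obtain ⟨U, hU⟩ := hC T hT
    exact ⟨U, hU.symm.hnot_eq⟩
  · rintro _ ⟨T, rfl⟩
    refine ⟨Set.range fun x => closedSublocale x ⊓ openSublocale (T.toNucleus x), ?_, ?_⟩
    · rintro _ ⟨x, rfl⟩
      exact (isComplemented_closedSublocale _).inf (isComplemented_openSublocale _)
    · rw [sSup_range]
      exact hnot_eq_iSup_closedSublocale_inf_openSublocale T

variable (L) in
theorem isCodenseSubcolocale_joinsOfComplemented :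
    IsCodenseSubcolocale (joinsOfComplemented L) :=
  joinsOfComplemented_eq_range_hnot L ▸ isCodenseSubcolocale_range_hnot (Sublocale L)

theorem openSublocale_mem_joinsOfComplemented (a : L) :
    openSublocale a ∈ joinsOfComplemented L :=
  ⟨{openSublocale a}, by rintro _ rfl; exact isComplemented_openSublocale a, sSup_singleton.symm⟩

end OpenClosed

section Exact

variable {L : Type*} [Order.Frame L] {S : Sublocale L} {A : Set L}

theorem IsExactMeet.image_sup (hA : IsExactMeet A) (y : L) : IsExactMeet ((· ⊔ y) '' A) := by
  intro z
  rw [sInf_image, ← hA y, sup_assoc, hA, iInf_image]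
  simp only [sup_assoc]

theorem coe_sInf_image_restrict (S : Sublocale L) (A : Set L) :
    ((sInf (S.restrict '' A) : S) : L) = ⨅ a ∈ A, S.toNucleus a := by
  simp only [sInf_image, Sublocale.coe_iInf, Sublocale.toNucleus_apply]

theorem isExactSublocale_iff :
    IsExactSublocale S ↔
      ∀ A : Set L, IsExactMeet A → S.toNucleus (sInf A) = ⨅ a ∈ A, S.toNucleus a := by
  have hmeet : (∀ A : Set L, IsExactMeet A → S.toNucleus (sInf A) = ⨅ a ∈ A, S.toNucleus a) ↔
      ∀ A : Set L, IsExactMeet A → sInf (S.restrict '' A) = S.restrict (sInf A) := by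
    simp only [Subtype.ext_iff, coe_sInf_image_restrict, Sublocale.toNucleus_apply, eq_comm]
  rw [hmeet]
  refine ⟨fun h A hA => (h A hA).2, fun h A hA => ⟨fun y => ?_, h A hA⟩⟩
  have hy : S.restrict y = y := Sublocale.restrict_of_mem y.2
  calc sInf (S.restrict '' A) ⊔ y = S.restrict (sInf ((· ⊔ (y : L)) '' A)) := by
        rw [h A hA, sInf_image, ← hA, map_sup, hy]
    _ = sInf (S.restrict '' ((· ⊔ (y : L)) '' A)) := (h _ (hA.image_sup y)).symm
    _ = ⨅ x ∈ S.restrict '' A, x ⊔ y := by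
        simp only [sInf_image, iInf_image, map_sup, hy]

theorem top_mem_exactSublocales : ⊤ ∈ exactSublocales L := by
  have hid : ∀ x : L, (⊤ : Sublocale L).toNucleus x = x := fun x =>
    toNucleus_eq_self ((le_top : closedSublocale x ≤ ⊤) (mem_closedSublocale.2 le_rfl))
  refine isExactSublocale_iff.2 fun A _ => ?_
  simp only [hid, sInf_eq_iInf]

theorem iSup_mem_exactSublocales {ι : Sort*} {S : ι → Sublocale L}
    (hS : ∀ i, S i ∈ exactSublocales L) : ⨆ i, S i ∈ exactSublocales L := by
  refine isExactSublocale_iff.2 fun A hA => ?_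
  simp only [toNucleus_iSup, isExactSublocale_iff.1 (hS _) A hA]
  rw [iInf_comm]
  exact iInf_congr fun a => iInf_comm

theorem inf_closedSublocale_mem_exactSublocales (hS : S ∈ exactSublocales L) (a : L) :
    S ⊓ closedSublocale a ∈ exactSublocales L := by
  refine isExactSublocale_iff.2 fun A hA => ?_
  simp only [toNucleus_inf_closedSublocale]
  rw [hA, ← sInf_image, isExactSublocale_iff.1 hS _ (hA.image_sup a), iInf_image]

theorem inf_openSublocale_mem_exactSublocales (hS : S ∈ exactSublocales L) (a : L) :
    S ⊓ openSublocale a ∈ exactSublocales L := by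
  refine isExactSublocale_iff.2 fun A hA => ?_
  simp only [toNucleus_inf_openSublocale, isExactSublocale_iff.1 hS A hA, himp_iInf_eq]

variable (L) in
theorem isCodenseSubcolocale_exactSublocales : IsCodenseSubcolocale (exactSublocales L) where
  left :=
    { sSup_mem := fun A hA => by
        rw [sSup_eq_iSup']
        exact iSup_mem_exactSublocales fun S => hA S.2
      sdiff_mem := fun S hS T => by
        simp only [sdiff_eq_iSup_inf_closedSublocale_inf_openSublocale, ← inf_assoc]
        exact iSup_mem_exactSublocales fun x => inf_openSublocale_mem_exactSublocales
          (inf_closedSublocale_mem_exactSublocales hS x) _ }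
  right := top_mem_exactSublocales

variable (L) in
theorem joinsOfComplemented_subset_exactSublocales :
    joinsOfComplemented L ⊆ exactSublocales L :=
  joinsOfComplemented_eq_range_hnot L ▸
    (isCodenseSubcolocale_exactSublocales L).range_hnot_subset

end Exact

section Fitting

variable {L : Type*} [Order.Frame L] {S T : Sublocale L} {F : Set L} {y : L}

/-- An exact filter is an upper set closed under exact meets; as finite meets are exact, it is a
filter. The opens containing an exact sublocale form one. -/
structure IsExactFilter (F : Set L) : Prop where
  isUpperSet : IsUpperSet F
  sInf_mem : ∀ A ⊆ F, IsExactMeet A → sInf A ∈ F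

theorem isExactFilter_setOf_le_openSublocale (hS : S ∈ exactSublocales L) :
    IsExactFilter {x | S ≤ openSublocale x} where
  isUpperSet := fun _ _ hxy hx => hx.trans (openSublocale_mono hxy)
  sInf_mem := fun A hAF hA => by
    refine le_openSublocale_iff.2 ((isExactSublocale_iff.1 hS A hA).trans ?_)
    exact iInf₂_eq_top.2 fun a ha => le_openSublocale_iff.1 (hAF ha)

theorem fit_congr (h : ∀ x, S ≤ openSublocale x ↔ T ≤ openSublocale x) : fit S = fit T :=
  congrArg sInf <| Set.ext fun _ =>
    exists_congr fun x => and_congr_right fun hU => by rw [hU, h x]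

theorem toNucleus_biSup_closedSublocale (F : Set L) (y : L) :
    (⨆ x ∈ F, closedSublocale x).toNucleus y = ⨅ x ∈ F, x ⊔ y := by
  simp only [toNucleus_iSup, toNucleus_closedSublocale, sup_comm]

theorem hnot_le_openSublocale_iff : ￢S ≤ openSublocale y ↔ closedSublocale y ≤ S := by
  rw [hnot_le_iff_codisjoint_right, (isCompl_closedSublocale_openSublocale y).left_le_iff]

theorem IsExactFilter.closedSublocale_le_biSup_iff (hF : IsExactFilter F) :
    closedSublocale y ≤ ⨆ x ∈ F, closedSublocale x ↔ y ∈ F := by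
  refine ⟨fun h => ?_, fun hy => le_biSup closedSublocale hy⟩
  have hfix : ∀ z, y ≤ z → ⨅ x ∈ F, x ⊔ z = z := fun z hz => by
    rw [← toNucleus_biSup_closedSublocale]
    exact toNucleus_eq_self (h (mem_closedSublocale.2 hz))
  have hinf : sInf ((· ⊔ y) '' F) = y := by rw [sInf_image, hfix y le_rfl]
  have hexact : IsExactMeet ((· ⊔ y) '' F) := fun z => by
    simp only [hinf, iInf_image, sup_assoc, hfix _ le_sup_left]
  rw [← hinf]
  refine hF.sInf_mem _ ?_ hexact
  rintro _ ⟨x, hx, rfl⟩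
  exact hF.isUpperSet le_sup_left hx

variable (L) in
theorem fit_image_joinsOfComplemented :
    fit '' joinsOfComplemented L = fit '' exactSublocales L := by
  refine (Set.image_mono (joinsOfComplemented_subset_exactSublocales L)).antisymm ?_
  rintro _ ⟨S, hS, rfl⟩
  refine ⟨￢⨆ x ∈ {x | S ≤ openSublocale x}, closedSublocale x, ?_, fit_congr fun y => ?_⟩
  · rw [joinsOfComplemented_eq_range_hnot]
    exact Set.mem_range_self _
  · exact hnot_le_openSublocale_iff.trans
      (isExactFilter_setOf_le_openSublocale hS).closedSublocale_le_biSup_iff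

theorem not_injOn_fit_image (h : joinsOfComplemented L ≠ exactSublocales L) :
    ¬ Set.InjOn (fun D : Set (Sublocale L) => fit '' D) {D | IsCodenseSubcolocale D} :=
  fun hinj => h <| hinj (isCodenseSubcolocale_joinsOfComplemented L)
    (isCodenseSubcolocale_exactSublocales L) (fit_image_joinsOfComplemented L)

end Fitting

section Essential

theorem conucleus_exactSublocales_sInf_openSublocale {L : Type*} [Order.Frame L] {A : Set L}
    (hA : IsExactMeet A) :
    conucleus (exactSublocales L) (sInf (openSublocale '' A)) = openSublocale (sInf A) := by
  refine le_antisymm (sSup_le fun D hD => ?_) (le_sSup ⟨?_, le_sInf ?_⟩)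
  · exact (isExactFilter_setOf_le_openSublocale hD.1).sInf_mem A
      (fun a ha => hD.2.trans (sInf_le ⟨a, ha, rfl⟩)) hA
  · exact joinsOfComplemented_subset_exactSublocales L (openSublocale_mem_joinsOfComplemented _)
  · rintro _ ⟨a, ha, rfl⟩
    exact openSublocale_mono (sInf_le ha)

theorem isExactMeet_of_completeDistribLattice {L : Type*} [CompleteDistribLattice L]
    (A : Set L) : IsExactMeet A :=
  fun _ => sInf_sup_eq

theorem not_isEssential_exactSublocales {L : Type*} [CompleteDistribLattice L]
    (h : joinsOfComplemented L ≠ exactSublocales L) : ¬ IsEssential (exactSublocales L) := by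
  intro hess
  refine h ((joinsOfComplemented_subset_exactSublocales L).antisymm ?_)
  refine hess.le.trans (generatedSubcolocale_subset
    (isCodenseSubcolocale_joinsOfComplemented L).1 ?_)
  rintro _ ⟨A, rfl⟩
  rw [conucleus_exactSublocales_sInf_openSublocale (isExactMeet_of_completeDistribLattice A)]
  exact openSublocale_mem_joinsOfComplemented _

end Essential

section LowerSets

variable {α : Type*}

variable (α) in
/-- The sublocale of left-closed lower sets, those containing `p` as soon as they contain
everything strictly below `p`. In a dense linear order without least element these are the
topologically closed lower sets. -/
def leftClosedLowerSets [PartialOrder α] : Sublocale (LowerSet α) where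
  carrier := {s | ∀ p, LowerSet.Iio p ≤ s → p ∈ s}
  sInf_mem' A hA p hp := LowerSet.mem_sInf_iff.2 fun s hs => hA hs p (hp.trans (sInf_le hs))
  himp_mem' t s hs p hp := by
    have hIic : LowerSet.Iic p ⊓ t ≤ s := by
      rintro q ⟨hqp : q ≤ p, hqt⟩
      rcases hqp.lt_or_eq with hlt | rfl
      · exact le_himp_iff.1 hp ⟨hlt, hqt⟩
      · exact hs q fun r hr => le_himp_iff.1 hp ⟨hr, t.lower (le_of_lt hr) hqt⟩
    exact le_himp_iff.2 hIic le_rfl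

theorem mem_leftClosedLowerSets [PartialOrder α] {s : LowerSet α} :
    s ∈ leftClosedLowerSets α ↔ ∀ p, LowerSet.Iio p ≤ s → p ∈ s := Iff.rfl

theorem Iio_notMem_leftClosedLowerSets [PartialOrder α] (p : α) :
    LowerSet.Iio p ∉ leftClosedLowerSets α :=
  fun h => lt_irrefl p (h p le_rfl)

variable [LinearOrder α]

theorem Iic_mem_leftClosedLowerSets [DenselyOrdered α] (q : α) :
    LowerSet.Iic q ∈ leftClosedLowerSets α :=
  fun _ h => le_of_forall_lt_imp_le_of_dense fun _ hr => h hr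

theorem leftClosedLowerSets_ne_bot [DenselyOrdered α] [Nontrivial α] :
    leftClosedLowerSets α ≠ ⊥ := by
  obtain ⟨q, r, hqr⟩ := exists_pair_lt α
  intro h
  have htop : LowerSet.Iic q = ⊤ := mem_bot.1 (h ▸ Iic_mem_leftClosedLowerSets q)
  exact hqr.not_ge (LowerSet.mem_Iic_iff.1 (htop ▸ LowerSet.mem_top))

theorem mem_toNucleus_leftClosedLowerSets_iff [DenselyOrdered α] {s : LowerSet α} {p : α} :
    p ∈ (leftClosedLowerSets α).toNucleus s ↔ LowerSet.Iio p ≤ s := by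
  refine ⟨fun hp q hqp => ?_, fun h =>
    mem_leftClosedLowerSets.1 (toNucleus_mem _ s) p (h.trans Nucleus.le_apply)⟩
  by_contra hqs
  have hsq : s ≤ LowerSet.Iic q := fun r hr => le_of_not_gt fun hqr => hqs (s.lower hqr.le hr)
  exact hqp.not_ge (toNucleus_le (Iic_mem_leftClosedLowerSets q) hsq hp)

variable (α) in
theorem leftClosedLowerSets_mem_exactSublocales [DenselyOrdered α] :
    leftClosedLowerSets α ∈ exactSublocales (LowerSet α) := by
  refine isExactSublocale_iff.2 fun A _ => LowerSet.ext (Set.ext fun p => ?_)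
  simp only [SetLike.mem_coe, LowerSet.mem_iInf_iff, mem_toNucleus_leftClosedLowerSets_iff,
    le_sInf_iff]

theorem Iio_mem_openSublocale {b : LowerSet α} {p : α} (hp : p ∈ b) :
    LowerSet.Iio p ∈ openSublocale b := by
  refine mem_openSublocale.2 (le_antisymm (fun q hq => ?_) le_himp)
  by_contra hqp
  have hp_himp : p ∈ b ⇨ LowerSet.Iio p := LowerSet.lower _ (le_of_not_gt hqp) hq
  have hmp : (b ⇨ LowerSet.Iio p) ⊓ b ≤ LowerSet.Iio p := himp_inf_le
  exact lt_irrefl p (hmp ⟨hp_himp, hp⟩)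

theorem exists_Iio_mem_of_mem_joinsOfComplemented {S : Sublocale (LowerSet α)}
    (hS : S ∈ joinsOfComplemented (LowerSet α)) (hne : S ≠ ⊥) :
    ∃ p, LowerSet.Iio p ∈ S := by
  rw [joinsOfComplemented_eq_range_hnot] at hS
  obtain ⟨T, rfl⟩ := hS
  by_contra! hIio
  simp only [hnot_eq_iSup_closedSublocale_inf_openSublocale] at hne hIio
  refine hne (iSup_eq_bot.2 fun a => closedSublocale_inf_openSublocale_eq_bot ?_)
  intro p hp
  by_contra hpa
  have hap : a ≤ LowerSet.Iio p := fun q hq => lt_of_not_ge fun hpq => hpa (a.lower hpq hq)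
  exact hIio p (le_iSup (fun x => closedSublocale x ⊓ openSublocale (T.toNucleus x)) a
    (mem_inf.2 ⟨hap, Iio_mem_openSublocale hp⟩))

variable (α) in
theorem joinsOfComplemented_lowerSet_ne_exactSublocales [DenselyOrdered α] [Nontrivial α] :
    joinsOfComplemented (LowerSet α) ≠ exactSublocales (LowerSet α) := by
  intro h
  obtain ⟨p, hp⟩ := exists_Iio_mem_of_mem_joinsOfComplemented
    (h.ge (leftClosedLowerSets_mem_exactSublocales α)) leftClosedLowerSets_ne_bot
  exact Iio_notMem_leftClosedLowerSets p hp

end LowerSets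

end PointfreeFit

open PointfreeFit in
theorem mainTheorem10_general :
    (∀ (L : Type*) [Order.Frame L],
      fit '' joinsOfComplemented L = fit '' exactSublocales L ∧
        IsCodenseSubcolocale (exactSublocales L)) ∧
    ∀ (α : Type*) [LinearOrder α] [DenselyOrdered α] [Nontrivial α],
      (¬ Set.InjOn (fun D : Set (Sublocale (LowerSet α)) => fit '' D)
        {D | IsCodenseSubcolocale D}) ∧
      ¬ IsEssential (exactSublocales (LowerSet α)) :=
  ⟨fun L _ => ⟨fit_image_joinsOfComplemented L, isCodenseSubcolocale_exactSublocales L⟩,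
    fun α _ _ _ =>
      have hne := joinsOfComplemented_lowerSet_ne_exactSublocales α
      ⟨not_injOn_fit_image hne, not_isEssential_exactSublocales hne⟩⟩

theorem mainTheorem10 :
    (∀ (L : Type*) [Order.Frame L],
      PointfreeFit.fit '' PointfreeFit.joinsOfComplemented L =
        PointfreeFit.fit '' PointfreeFit.exactSublocales L) ∧
    ∃ (L : Type) (_ : Order.Frame L),
      (¬ Set.InjOn (fun D : Set (Sublocale L) => PointfreeFit.fit '' D)
        {D | PointfreeFit.IsCodenseSubcolocale D}) ∧
      PointfreeFit.IsCodenseSubcolocale (PointfreeFit.exactSublocales L) ∧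
      ¬ PointfreeFit.IsEssential (PointfreeFit.exactSublocales L) :=
  ⟨fun L _ => (mainTheorem10_general.{_, 0}.1 L).1, LowerSet ℝ, inferInstance,
    (mainTheorem10_general.{0, 0}.2 ℝ).1, (mainTheorem10_general.{0, 0}.1 _).2,
    (mainTheorem10_general.{0, 0}.2 ℝ).2⟩
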